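/- Let $N\ge 0$ and $r,s\ge 1$ be integers, and let $A=(A_{k,l})_{k,l\ge 0}$ be an infinite matrix with blocks $A_{k,l}\in\mathbb C^{N\times N}$ such that $A_{k,l}=0$ whenever $l<k-s$ or $l>k+r$, the blocks $A_{k,k+r}$ and $A_{k+s,k}$ are invertible for all $k\ge 0$, and $\sup_{i,j\ge0}\|A_{i,j}\|<\infty$. Then $A$ defines a bounded operator, again denoted $A$, on the Hilbert space $\ell^2_N$ of square summable sequences $(u_k)_{k\ge0}$ with $u_k\in\mathbb C^N$. Let $\lambda\in\mathbb C$ belong to the resolvent set of $A$, write $(\lambda I-A)^{-1}=(\tilde R_{i,j})_{i,j\ge0}$ with $\tilde R_{i,j}\in\mathbb C^{N\times N}$, and let $\mathfrak M=(\mathfrak M_{i,j})_{1\le i\le r,\,1\le j\le s}$, $\mathfrak M_{i,j}=\tilde R_{i-1,j-1}$, be the Weyl matrix of $A$. Denote by $E$ and $0$ the unit and zero matrices of order $N$, and extend the blocks to negative indices by $A_{k,k-s}=-E$ for $0\le k<s$ and $A_{k-r,k}=-E$ for $0\le k<r$, all other blocks with exactly one negative index being $0$. Let $Q_k(\lambda)=(Q^1_k,\dots,Q^r_k)$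 and $P_k(\lambda)=(P^1_k,\dots,P^s_k)$, $k\ge -s$, be the solutions in $\mathbb C^{N\times N}$ of $$\sum_{l=k-s}^{k+r}A_{k,l}Y_l=\lambda Y_k,\qquad k\ge 0,$$ with initial values $Q^i_{k}=\delta_{k,i-1}E$ and $P^j_{k}=\delta_{k,j-1-s}E$ for $-s\le k\le r-1$. Let $Q^+_n(\lambda)=(Q^{1,+}_n,\dots,Q^{s,+}_n)^T$ and $P^+_n(\lambda)=(P^{1,+}_n,\dots,P^{r,+}_n)^T$ (block columns, no transposition of the blocks), $n\ge -r$, be the solutions of the dual equation $$\sum_{l=k-r}^{k+s}Y^+_lA_{l,k}=\lambda Y^+_k,\qquad k\ge 0,$$ with initial values $Q^{j,+}_{n}=\delta_{n,j-1}E$ and $P^{i,+}_{n}=\delta_{n,i-1-r}E$ for $-r\le n\le s-1$. Put $R_k(\lambda)=Q_k(\lambda)\mathfrak M-P_k(\lambda)=(R^1_k,\dots,R^s_k)$ and $R^+_n(\lambda)=\mathfrak MQ^+_n(\lambda)-P^+_n(\lambda)=(R^{1,+}_n,\dots,R^{r,+}_n)^T$. Then, for every norm $\|\cdot\|$ on $\mathbb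 C^{N\times N}$, $$\limsup_{k\to\infty}\|R^j_k(\lambda)\|^{1/k}<1\quad(1\le j\le s),\qquad \limsup_{n\to\infty}\|R^{i,+}_n(\lambda)\|^{1/n}<1\quad(1\le i\le r).$$ -/

import Mathlib

open Filter Topology
open scoped Matrix

noncomputable section

/-- The block algebra `ℂ^{N × N}`. -/
abbrev Blk (N : ℕ) : Type := Matrix (Fin N) (Fin N) ℂ

/-- The Hilbert space `ℓ²_N` of square summable sequences of vectors in `ℂ^N`
(with the Euclidean norm). -/
abbrev EllTwo (N : ℕ) : Type := lp (fun _ : ℕ => EuclideanSpace ℂ (Fin N)) 2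

/-- An infinite band matrix `(A_{k,l})_{k,l ≥ 0}` with blocks of order `N`: `A_{k,l} = 0` if
`l < k - s` or `l > k + r`, and the extreme blocks `A_{k,k+r}`, `A_{k+s,k}` are invertible. -/
structure BandMatrix (N r s : ℕ) where
  /-- the blocks -/
  entry : ℕ → ℕ → Blk N
  lower_zero : ∀ k l : ℕ, l + s < k → entry k l = 0
  upper_zero : ∀ k l : ℕ, k + r < l → entry k l = 0
  isUnit_upper : ∀ k : ℕ, IsUnit (entry k (k + r))
  isUnit_lower : ∀ k : ℕ, IsUnit (entry (k + s) k)

/-- A seminorm which is a norm. -/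
def IsNorm {N : ℕ} (ν : Seminorm ℂ (Blk N)) : Prop := ∀ X : Blk N, ν X = 0 → X = 0

namespace BandMatrix

variable {N r s : ℕ}

/-- The blocks are uniformly bounded, `sup_{i,j} ‖A_{i,j}‖ < ∞`, in a certain norm on the
space of matrices of order `N`. -/
def IsBounded (A : BandMatrix N r s) : Prop :=
  ∃ ν : Seminorm ℂ (Blk N), IsNorm ν ∧ ∃ C : ℝ, ∀ i j : ℕ, ν (A.entry i j) ≤ C

/-! ### The operator generated by the matrix -/

/-- The formal product of the infinite matrix with a sequence of vectors:
`(A u)_k = ∑_l A_{k,l} u_l`, where only `l ≤ k + r` contribute. -/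
def act (A : BandMatrix N r s) (u : ℕ → EuclideanSpace ℂ (Fin N)) (k : ℕ) :
    EuclideanSpace ℂ (Fin N) :=
  ∑ l ∈ Finset.range (k + r + 1), Matrix.toEuclideanLin (A.entry k l) (u l)

theorem linear_bound {V F : Type*} [NormedAddCommGroup V] [NormedSpace ℂ V]
    [FiniteDimensional ℂ V] [NormedAddCommGroup F] [NormedSpace ℂ F] (f : V →ₗ[ℂ] F) :
    ∃ K : ℝ, 0 ≤ K ∧ ∀ x, ‖f x‖ ≤ K * ‖x‖ :=
  ⟨‖LinearMap.toContinuousLinearMap f‖, norm_nonneg _,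
    fun x => (LinearMap.toContinuousLinearMap f).le_opNorm x⟩

theorem norm_bound (ν : Seminorm ℂ (Blk N)) (hν : IsNorm ν) :
    ∃ K : ℝ, 0 ≤ K ∧ ∀ (X : Blk N) (v : EuclideanSpace ℂ (Fin N)),
      ‖Matrix.toEuclideanLin X v‖ ≤ K * ν X * ‖v‖ := by
  let i1 : NormedAddCommGroup (Blk N) := AddGroupNorm.toNormedAddCommGroup
    { toFun := ν
      map_zero' := map_zero ν
      add_le' := map_add_le_add ν
      neg' := map_neg_eq_map ν
      eq_zero_of_map_eq_zero' := fun X => hν X }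
  let i2 : NormedSpace ℂ (Blk N) := { norm_smul_le := fun c X => (map_smul_eq_mul ν c X).le }
  obtain ⟨K, hK, h⟩ := linear_bound (V := Blk N)
    (LinearMap.toContinuousLinearMap.toLinearMap ∘ₗ
      (Matrix.toEuclideanLin (𝕜 := ℂ) (m := Fin N) (n := Fin N)).toLinearMap)
  refine ⟨K, hK, fun X v => ?_⟩
  refine ((LinearMap.toContinuousLinearMap (Matrix.toEuclideanLin X)).le_opNorm v).trans ?_
  exact mul_le_mul_of_nonneg_right (h X) (norm_nonneg v)

theorem IsBounded.exists_bound {A : BandMatrix N r s} (hA : A.IsBounded) :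
    ∃ c : ℝ, 0 ≤ c ∧ ∀ (k l : ℕ) (v : EuclideanSpace ℂ (Fin N)),
      ‖Matrix.toEuclideanLin (A.entry k l) v‖ ≤ c * ‖v‖ := by
  obtain ⟨ν, hν, C, hC⟩ := hA
  obtain ⟨K, hK, h⟩ := norm_bound ν hν
  refine ⟨K * C, mul_nonneg hK ((apply_nonneg ν _).trans (hC 0 0)), fun k l v => ?_⟩
  exact (h _ v).trans
    (mul_le_mul_of_nonneg_right (mul_le_mul_of_nonneg_left (hC k l) hK) (norm_nonneg v))

theorem act_eq_sum_diag (A : BandMatrix N r s) (u : ℕ → EuclideanSpace ℂ (Fin N)) (k : ℕ) :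
    A.act u k = ∑ d ∈ Finset.range (r + s + 1),
      if s ≤ k + d then
        Matrix.toEuclideanLin (A.entry k (k + d - s)) (u (k + d - s)) else 0 := by
  rw [← Finset.sum_filter]
  unfold act
  symm
  refine Finset.sum_of_injOn (fun d => k + d - s) ?_ ?_ ?_ ?_
  · intro a ha b hb hab
    simp only [Finset.coe_filter, Set.mem_ofPred_eq, Finset.mem_range] at ha hb hab
    omega
  · intro a ha
    simp only [Finset.coe_filter, Set.mem_ofPred_eq, Finset.mem_range, Finset.coe_range,
      Set.mem_Iio] at ha ⊢
    omega
  · intro l hl hl'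
    simp only [Finset.mem_range, Finset.coe_filter, Set.mem_image, Set.mem_ofPred_eq] at hl hl'
    by_cases h : l + s < k
    · rw [A.lower_zero k l h]; simp
    · exact absurd ⟨l + s - k, by omega, by omega⟩ hl'
  · intro d _; rfl

theorem act_memℓp {A : BandMatrix N r s} (hA : A.IsBounded) (u : EllTwo N) :
    Memℓp (A.act u) 2 := by
  obtain ⟨c, hc, h⟩ := hA.exists_bound
  have hu : Summable fun l => ‖u l‖ ^ 2 := by
    have := (memℓp_gen_iff (p := 2) (by norm_num)).1 u.2
    simpa using this
  have hfun : A.act u = fun k => ∑ d ∈ Finset.range (r + s + 1),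
      if s ≤ k + d then
        Matrix.toEuclideanLin (A.entry k (k + d - s)) (u (k + d - s)) else 0 :=
    funext (A.act_eq_sum_diag u)
  rw [hfun]
  refine Memℓp.finsetSum _ (f := fun d k => if s ≤ k + d then
        Matrix.toEuclideanLin (A.entry k (k + d - s)) (u (k + d - s)) else 0) ?_
  intro d _
  refine (memℓp_gen_iff (p := 2) (by norm_num)).2 ?_
  rw [← summable_nat_add_iff s]
  refine Summable.of_nonneg_of_le (fun k => by positivity) (fun k => ?_)
    (((summable_nat_add_iff d).2 hu).mul_left (c ^ 2))
  have e : k + s + d - s = k + d := by omega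
  have e' : s ≤ k + s + d := by omega
  simp only [e, e', if_true, ENNReal.toReal_ofNat, Real.rpow_ofNat]
  rw [← mul_pow]
  exact pow_le_pow_left₀ (norm_nonneg _) (h _ _ _) 2

/-- The operator on `ℓ²_N` generated by a bounded band matrix, as a linear map. -/
def linearOp (A : BandMatrix N r s) (hA : A.IsBounded) : EllTwo N →ₗ[ℂ] EllTwo N where
  toFun u := ⟨A.act u, act_memℓp hA u⟩
  map_add' u v := by
    ext1
    funext k
    change A.act (⇑(u + v)) k = A.act u k + A.act v k
    simp [act, Finset.sum_add_distrib]
  map_smul' c u := by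
    ext1
    funext k
    simp [act, Finset.smul_sum]

/-- The bounded operator on `ℓ²_N` generated by a bounded band matrix. -/
def operator (A : BandMatrix N r s) (hA : A.IsBounded) : EllTwo N →L[ℂ] EllTwo N :=
  ContinuousLinearMap.ofSeqClosedGraph (g := A.linearOp hA) (by
    intro u x y hx hy
    ext1
    funext k
    have h1 := ((lp.evalCLM ℂ (fun _ : ℕ => EuclideanSpace ℂ (Fin N)) 2 k).continuous.tendsto
      y).comp hy
    have h2 : Tendsto (fun n => A.act (u n) k) atTop (𝓝 (A.act x k)) := by
      unfold act
      refine tendsto_finsetSum _ fun l _ => ?_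
      have h3 := ((lp.evalCLM ℂ (fun _ : ℕ => EuclideanSpace ℂ (Fin N)) 2 l).continuous.tendsto
        x).comp hx
      exact ((LinearMap.continuous_of_finiteDimensional
        (Matrix.toEuclideanLin (A.entry k l))).tendsto _).comp h3
    exact tendsto_nhds_unique h1 h2)

theorem operator_apply (A : BandMatrix N r s) (hA : A.IsBounded) (u : EllTwo N) (k : ℕ) :
    A.operator hA u k
      = ∑ l ∈ Finset.range (k + r + 1), Matrix.toEuclideanLin (A.entry k l) (u l) := rfl

/-- The block `(i, j)` of the matrix representation of an operator on `ℓ²_N`: its column `b`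
is the component `i` of the image of the unit vector number `b` placed at position `j`. -/
def blockOf (T : EllTwo N →L[ℂ] EllTwo N) (i j : ℕ) : Blk N :=
  Matrix.of fun a b => (T (lp.single 2 j (EuclideanSpace.single b (1 : ℂ))) i) a

/-- The Weyl matrix: the upper left `r × s` corner of blocks of the resolvent
`(z I - A)⁻¹`. -/
def weyl (A : BandMatrix N r s) (hA : A.IsBounded) (z : ℂ) (i : Fin r) (j : Fin s) : Blk N :=
  blockOf (resolvent (A.operator hA) z) i j

/-! ### The difference equations and their polynomial solutions -/

/-- The blocks extended to negative indices: `A_{k,k-s} = -E` for `0 ≤ k < s`,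
`A_{l-r,l} = -E` for `0 ≤ l < r`, all the other new blocks being zero. -/
def ext (A : BandMatrix N r s) (k l : ℤ) : Blk N :=
  if 0 ≤ k ∧ 0 ≤ l then A.entry k.toNat l.toNat
  else if 0 ≤ k ∧ l = k - s then -1
  else if 0 ≤ l ∧ k = l - r then -1
  else 0

/-- `Y` solves `∑_{l=k-s}^{k+r} A_{k,l} Y_l = z Y_k` for `k ≥ 0`. -/
def IsSolution (A : BandMatrix N r s) (z : ℂ) (Y : ℤ → Blk N) : Prop :=
  ∀ k : ℤ, 0 ≤ k → ∑ l ∈ Finset.Icc (k - s) (k + r), A.ext k l * Y l = z • Y k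

/-- `Y` solves the dual equation `∑_{l=k-r}^{k+s} Y_l A_{l,k} = z Y_k` for `k ≥ 0`. -/
def IsDualSolution (A : BandMatrix N r s) (z : ℂ) (Y : ℤ → Blk N) : Prop :=
  ∀ k : ℤ, 0 ≤ k → ∑ l ∈ Finset.Icc (k - r) (k + s), Y l * A.ext l k = z • Y k

/-- The solution of the difference equation with given initial values at the indices `< r`:
for `n = k + r ≥ r`, the equation at `k` is solved for `Y_n`. -/
def sol (A : BandMatrix N r s) (z : ℂ) (init : ℤ → Blk N) (n : ℤ) : Blk N :=
  if n < r then init n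
  else (A.ext (n - r) n)⁻¹ * ∑ l ∈ (Finset.Ico (n - r - s) n).attach,
    ((if (l : ℤ) = n - r then z • (1 : Blk N) else 0) - A.ext (n - r) l) * sol A z init l
termination_by (n - r + 1).toNat
decreasing_by
  have := Finset.mem_Ico.1 l.2
  omega

/-- The solution of the dual equation with given initial values at the indices `< s`:
for `n = k + s ≥ s`, the equation at `k` is solved for `Y_n`. -/
def dualSol (A : BandMatrix N r s) (z : ℂ) (init : ℤ → Blk N) (n : ℤ) : Blk N :=
  if n < s then init n
  else (∑ l ∈ (Finset.Ico (n - s - r) n).attach, dualSol A z init l *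
    ((if (l : ℤ) = n - s then z • (1 : Blk N) else 0) - A.ext l (n - s))) * (A.ext n (n - s))⁻¹
termination_by (n - s + 1).toNat
decreasing_by
  have := Finset.mem_Ico.1 l.2
  omega

theorem sol_of_lt (A : BandMatrix N r s) (z : ℂ) (init : ℤ → Blk N) {n : ℤ} (hn : n < r) :
    A.sol z init n = init n := by
  rw [sol, if_pos hn]

theorem dualSol_of_lt (A : BandMatrix N r s) (z : ℂ) (init : ℤ → Blk N) {n : ℤ} (hn : n < s) :
    A.dualSol z init n = init n := by
  rw [dualSol, if_pos hn]

theorem isSolution_sol (hr : 0 < r) (A : BandMatrix N r s) (z : ℂ) (init : ℤ → Blk N) :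
    A.IsSolution z (A.sol z init) := by
  intro k hk
  have hu : IsUnit (A.ext k (k + r)) := by
    obtain ⟨m, rfl⟩ := Int.eq_ofNat_of_zero_le hk
    have h1 : (0 : ℤ) ≤ m ∧ (0 : ℤ) ≤ (m : ℤ) + r := by omega
    have h2 : ((m : ℤ) + r).toNat = m + r := by omega
    rw [ext, if_pos h1, h2]
    simpa using A.isUnit_upper m
  have hlast : A.ext k (k + r) * A.sol z init (k + r)
      = ∑ l ∈ Finset.Ico (k - s) (k + r),
        ((if l = k then z • (1 : Blk N) else 0) - A.ext k l) * A.sol z init l := by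
    have e : k + (r : ℤ) - r = k := by omega
    conv_lhs => rw [sol]
    rw [if_neg (by omega), e, Matrix.mul_nonsing_inv_cancel_left _ _
      ((Matrix.isUnit_iff_isUnit_det _).1 hu)]
    exact Finset.sum_attach (Finset.Ico (k - (s : ℤ)) (k + r)) (fun l =>
      ((if l = k then z • (1 : Blk N) else 0) - A.ext k l) * A.sol z init l)
  have hI : Finset.Icc (k - (s : ℤ)) (k + r)
      = insert (k + (r : ℤ)) (Finset.Ico (k - (s : ℤ)) (k + r)) := by
    ext l; simp only [Finset.mem_Icc, Finset.mem_insert, Finset.mem_Ico]; omega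
  rw [hI, Finset.sum_insert (by simp), hlast, ← Finset.sum_add_distrib]
  rw [Finset.sum_eq_single k]
  · simp [← add_mul]
  · intro l _ hl
    simp [hl]
  · intro h
    exact absurd (Finset.mem_Ico.2 ⟨by omega, by omega⟩) h

theorem isDualSolution_dualSol (hs : 0 < s) (A : BandMatrix N r s) (z : ℂ)
    (init : ℤ → Blk N) : A.IsDualSolution z (A.dualSol z init) := by
  intro k hk
  have hu : IsUnit (A.ext (k + s) k) := by
    obtain ⟨m, rfl⟩ := Int.eq_ofNat_of_zero_le hk
    have h1 : (0 : ℤ) ≤ (m : ℤ) + s ∧ (0 : ℤ) ≤ m := by omega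
    have h2 : ((m : ℤ) + s).toNat = m + s := by omega
    rw [ext, if_pos h1, h2]
    simpa using A.isUnit_lower m
  have hlast : A.dualSol z init (k + s) * A.ext (k + s) k
      = ∑ l ∈ Finset.Ico (k - r) (k + s), A.dualSol z init l *
        ((if l = k then z • (1 : Blk N) else 0) - A.ext l k) := by
    have e : k + (s : ℤ) - s = k := by omega
    conv_lhs => rw [dualSol]
    rw [if_neg (by omega), e, Matrix.nonsing_inv_mul_cancel_right _ _
      ((Matrix.isUnit_iff_isUnit_det _).1 hu)]
    exact Finset.sum_attach (Finset.Ico (k - (r : ℤ)) (k + s)) (fun l =>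
      A.dualSol z init l * ((if l = k then z • (1 : Blk N) else 0) - A.ext l k))
  have hI : Finset.Icc (k - (r : ℤ)) (k + s)
      = insert (k + (s : ℤ)) (Finset.Ico (k - (r : ℤ)) (k + s)) := by
    ext l; simp only [Finset.mem_Icc, Finset.mem_insert, Finset.mem_Ico]; omega
  rw [hI, Finset.sum_insert (by simp), hlast, ← Finset.sum_add_distrib]
  rw [Finset.sum_eq_single k]
  · simp [← mul_add]
  · intro l _ hl
    simp [hl]
  · intro h
    exact absurd (Finset.mem_Ico.2 ⟨by omega, by omega⟩) h

/-- The initial values equal to `E` at the index `m` and to zero elsewhere. -/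
def unitInit (N : ℕ) (m n : ℤ) : Blk N := if n = m then 1 else 0

/-- `Q^i` (`i` counted from `0`): `Q_{0:r-1} = I_r`, `Q_{-s:-1} = 0`. -/
def Q (A : BandMatrix N r s) (z : ℂ) (i : Fin r) : ℤ → Blk N :=
  A.sol z (unitInit N (i : ℕ))

/-- `P^j` (`j` counted from `0`): `P_{-s:-1} = I_s`, `P_{0:r-1} = 0`. -/
def P (A : BandMatrix N r s) (z : ℂ) (j : Fin s) : ℤ → Blk N :=
  A.sol z (unitInit N ((j : ℕ) - (s : ℤ)))

/-- `Q^{j,+}` (`j` counted from `0`): `Q^+_{0:s-1} = I_s`, `Q^+_{-r:-1} = 0`. -/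
def Qdual (A : BandMatrix N r s) (z : ℂ) (j : Fin s) : ℤ → Blk N :=
  A.dualSol z (unitInit N (j : ℕ))

/-- `P^{i,+}` (`i` counted from `0`): `P^+_{-r:-1} = I_r`, `P^+_{0:s-1} = 0`. -/
def Pdual (A : BandMatrix N r s) (z : ℂ) (i : Fin r) : ℤ → Blk N :=
  A.dualSol z (unitInit N ((i : ℕ) - (r : ℤ)))

/-- The block `j` of the block row `R_k(z) = Q_k(z) 𝔐 - P_k(z)`. -/
def R (A : BandMatrix N r s) (z : ℂ) (M : Fin r → Fin s → Blk N) (j : Fin s) (k : ℤ) : Blk N :=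
  ∑ i : Fin r, A.Q z i k * M i j - A.P z j k

/-- The block `i` of the block column `R_n^+(z) = 𝔐 Q_n^+(z) - P_n^+(z)`. -/
def Rdual (A : BandMatrix N r s) (z : ℂ) (M : Fin r → Fin s → Blk N) (i : Fin r) (n : ℤ) :
    Blk N :=
  ∑ j : Fin s, M i j * A.Qdual z j n - A.Pdual z i n

end BandMatrix

end

noncomputable section

open BandMatrix

/-! ### Weighted shifts on `ℓ²_N` -/

/-! The sequences `R^j` and `R^{i,+}` are the first `s` block columns and the first `r` block rows
of the resolvent `T = (z - A)⁻¹`, and the blocks of `T` decay geometrically away from the diagonal.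

Decay: let `D` be the diagonal operator with entries `q^k`, `0 < q < 1`. Formally `D⁻¹ A D` has the
blocks `q^{l-k} A_{k,l}`. Since `A` has finitely many diagonals, this twisted matrix is bounded and
tends to `A` in operator norm as `q → 1`; so does `D A D⁻¹`. Invertibility is an open condition,
hence for some `q < 1` both twisted versions of `z - A` have bounded inverses. These inverses are
`D⁻¹ T D` and `D T D⁻¹`, and boundedness of their blocks gives `T_{i,j} = O(q^{|i-j|})`
(`exists_decay`).

Identification: the equations `(z - A) T = 1` and `T (z - A) = 1`, read blockwise, become the
homogeneous recurrence and its dual once the unit on the right is absorbed by a value `-E` at one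
negative index. Both sides then have equal initial values, and the invertible extreme blocks make
solutions unique (`R_weyl`, `Rdual_weyl`). -/

theorem summable_norm_sq {N : ℕ} (u : EllTwo N) : Summable fun l => ‖u l‖ ^ 2 := by
  have := (memℓp_gen_iff (p := 2) (by norm_num)).1 u.2
  simpa using this

/-- The sequence of the bounded operators `M k` applied to a shift of `u`. -/
def shiftFun {N : ℕ} (d s : ℕ)
    (M : ℕ → EuclideanSpace ℂ (Fin N) →L[ℂ] EuclideanSpace ℂ (Fin N))
    (u : ℕ → EuclideanSpace ℂ (Fin N)) (k : ℕ) : EuclideanSpace ℂ (Fin N) :=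
  if s ≤ k + d then M k (u (k + d - s)) else 0

theorem memℓp_shiftFun {N : ℕ} (d s : ℕ)
    (M : ℕ → EuclideanSpace ℂ (Fin N) →L[ℂ] EuclideanSpace ℂ (Fin N))
    {c : ℝ} (hM : ∀ k v, ‖M k v‖ ≤ c * ‖v‖) (u : EllTwo N) :
    Memℓp (shiftFun d s M u) 2 := by
  refine (memℓp_gen_iff (p := 2) (by norm_num)).2 ?_
  -- Dropping the first `s` terms makes the condition `s ≤ k + d` automatic and removes the
  -- truncated subtraction.
  rw [← summable_nat_add_iff s]
  refine Summable.of_nonneg_of_le (fun k => by positivity) (fun k => ?_)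
    (((summable_nat_add_iff d).2 (summable_norm_sq u)).mul_left (c ^ 2))
  have e : k + s + d - s = k + d := by omega
  have e' : s ≤ k + s + d := by omega
  simp only [shiftFun, e, e', if_true, ENNReal.toReal_ofNat, Real.rpow_ofNat]
  rw [← mul_pow]
  exact pow_le_pow_left₀ (norm_nonneg _) (hM _ _) 2

/-- The weighted shift as a bounded operator. -/
def weightedShift {N : ℕ} (d s : ℕ)
    (M : ℕ → EuclideanSpace ℂ (Fin N) →L[ℂ] EuclideanSpace ℂ (Fin N))
    {c : ℝ} (hM : ∀ k v, ‖M k v‖ ≤ c * ‖v‖) : EllTwo N →L[ℂ] EllTwo N :=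
  -- Closed graph theorem: convergence in `ℓ²` implies convergence of each component, and each
  -- component of the image depends on one component of `u`.
  ContinuousLinearMap.ofSeqClosedGraph
    (g := { toFun := fun u => ⟨shiftFun d s M u, memℓp_shiftFun d s M hM u⟩
            map_add' := fun u v => by
              ext1; funext k
              change shiftFun d s M (⇑(u + v)) k = shiftFun d s M u k + shiftFun d s M v k
              simp only [shiftFun]
              split_ifs <;> simp
            map_smul' := fun a u => by
              ext1; funext k
              change shiftFun d s M (⇑(a • u)) k = a • shiftFun d s M u k
              simp only [shiftFun]
              split_ifs <;> simp }) (by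
    intro u x y hx hy
    ext1
    funext k
    have h1 := ((lp.evalCLM ℂ (fun _ : ℕ => EuclideanSpace ℂ (Fin N)) 2 k).continuous.tendsto
      y).comp hy
    have h2 : Tendsto (fun n => shiftFun d s M (u n) k) atTop (𝓝 (shiftFun d s M x k)) := by
      unfold shiftFun
      split_ifs
      · have h3 := ((lp.evalCLM ℂ (fun _ : ℕ => EuclideanSpace ℂ (Fin N)) 2
          (k + d - s)).continuous.tendsto x).comp hx
        exact ((M k).continuous.tendsto _).comp h3
      · exact tendsto_const_nhds
    exact tendsto_nhds_unique h1 h2)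

theorem weightedShift_apply {N : ℕ} (d s : ℕ)
    (M : ℕ → EuclideanSpace ℂ (Fin N) →L[ℂ] EuclideanSpace ℂ (Fin N))
    {c : ℝ} (hM : ∀ k v, ‖M k v‖ ≤ c * ‖v‖) (u : EllTwo N) (k : ℕ) :
    weightedShift d s M hM u k = if s ≤ k + d then M k (u (k + d - s)) else 0 := rfl

/-- The diagonal operator with the entries `q ^ k`, for `q ∈ [0, 1]`. -/
def geomOp (N : ℕ) (q : ℝ) (h0 : 0 ≤ q) (h1 : q ≤ 1) : EllTwo N →L[ℂ] EllTwo N :=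
  weightedShift 0 0 (fun k => ((q : ℂ) ^ k) • ContinuousLinearMap.id ℂ _) (c := 1) (by
    intro k v
    simp only [_root_.smul_apply, ContinuousLinearMap.id_apply, norm_smul, norm_pow,
      Complex.norm_real, Real.norm_of_nonneg h0]
    exact mul_le_mul_of_nonneg_right (pow_le_one₀ h0 h1) (norm_nonneg v))

theorem geomOp_apply {N : ℕ} {q : ℝ} (h0 : 0 ≤ q) (h1 : q ≤ 1) (u : EllTwo N) (k : ℕ) :
    geomOp N q h0 h1 u k = (q : ℂ) ^ k • u k := by
  simp [geomOp, weightedShift_apply]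

theorem geomOp_single {N : ℕ} {q : ℝ} (h0 : 0 ≤ q) (h1 : q ≤ 1) (j : ℕ)
    (v : EuclideanSpace ℂ (Fin N)) :
    geomOp N q h0 h1 (lp.single 2 j v) = (q : ℂ) ^ j • lp.single 2 j v := by
  ext1
  funext k
  rw [geomOp_apply, lp.coeFn_smul, Pi.smul_apply]
  by_cases h : k = j
  · subst h; rfl
  · simp [lp.single_apply, Pi.single_eq_of_ne h]

/-! ### Blocks of operators -/

theorem norm_blockOf_le {N : ℕ} (T : EllTwo N →L[ℂ] EllTwo N) (i j : ℕ) (a b : Fin N) :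
    ‖blockOf T i j a b‖ ≤ ‖T‖ := by
  have h1 : ‖T (lp.single 2 j (EuclideanSpace.single b (1 : ℂ)))‖ ≤ ‖T‖ := by
    refine (T.le_opNorm _).trans ?_
    rw [lp.norm_single (by norm_num)]
    simp
  exact ((PiLp.norm_apply_le _ a).trans (lp.norm_apply_le_norm (by norm_num) _ i)).trans h1

theorem blockOf_one {N : ℕ} (i j : ℕ) :
    blockOf (1 : EllTwo N →L[ℂ] EllTwo N) i j = if i = j then 1 else 0 := by
  ext a b
  simp only [blockOf, Matrix.of_apply, one_apply_eq_self, lp.single_apply]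
  by_cases h : i = j
  · subst h
    simp [Matrix.one_apply, PiLp.single_apply]
  · simp [h]

theorem blockOf_smul_one_sub {N : ℕ} (z : ℂ) (S T : EllTwo N →L[ℂ] EllTwo N) (i j : ℕ) :
    blockOf (z • T - S) i j = z • blockOf T i j - blockOf S i j := by
  rfl

/-- The seminorm of a matrix is bounded in terms of a bound of its entries. -/
theorem seminorm_le_of_entries {N : ℕ} (ν : Seminorm ℂ (Blk N)) :
    ∃ K : ℝ, ∀ (X : Blk N) (c : ℝ), (∀ a b, ‖X a b‖ ≤ c) → ν X ≤ K * c := by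
  refine ⟨∑ a, ∑ b, ν (Matrix.single a b 1), fun X c h => ?_⟩
  have hadd : ∀ (f : Fin N → Blk N), ν (∑ a, f a) ≤ ∑ a, ν (f a) := fun f =>
    Finset.le_sum_of_subadditive ν (map_zero ν).le (map_add_le_add ν) _ _
  conv_lhs => rw [Matrix.matrix_eq_sum_single X]
  refine (hadd _).trans ?_
  rw [Finset.sum_mul]
  refine Finset.sum_le_sum fun a _ => (hadd _).trans ?_
  rw [Finset.sum_mul]
  refine Finset.sum_le_sum fun b _ => ?_
  have : Matrix.single a b (X a b) = X a b • (Matrix.single a b 1 : Blk N) := by simp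
  rw [this, map_smul_eq_mul, mul_comm]
  exact mul_le_mul_of_nonneg_left (h a b) (apply_nonneg ν _)

theorem limsup_root_lt_one {f : ℕ → ℝ} (hf : ∀ k, 0 ≤ f k) {C q : ℝ} (h0 : 0 < q) (h1 : q < 1)
    (h : ∀ k, f k ≤ C * q ^ k) :
    limsup (fun k : ℕ => ENNReal.ofReal (f k ^ (1 / (k : ℝ)))) atTop < 1 := by
  -- `C` may be zero or negative; `|C| + 1` is a positive majorant, so its `k`-th root tends to `1`.
  have hC : (0 : ℝ) < |C| + 1 := by positivity
  have hlim : Tendsto (fun k : ℕ => ENNReal.ofReal ((|C| + 1) ^ (1 / (k : ℝ)) * q)) atTop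
      (𝓝 (ENNReal.ofReal q)) := by
    refine ENNReal.tendsto_ofReal ?_
    have h2 : Tendsto (fun k : ℕ => (|C| + 1) ^ (1 / (k : ℝ))) atTop (𝓝 ((|C| + 1) ^ (0 : ℝ))) :=
      (Real.continuousAt_const_rpow hC.ne').tendsto.comp tendsto_one_div_atTop_nhds_zero_nat
    simpa using h2.mul_const q
  refine lt_of_le_of_lt (limsup_le_limsup (v := fun k : ℕ =>
    ENNReal.ofReal ((|C| + 1) ^ (1 / (k : ℝ)) * q)) ?_) ?_
  · filter_upwards [eventually_gt_atTop 0] with k hk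
    refine ENNReal.ofReal_le_ofReal ?_
    have h3 : f k ≤ (|C| + 1) * q ^ k := (h k).trans
      (mul_le_mul_of_nonneg_right (by linarith [le_abs_self C]) (by positivity))
    refine (Real.rpow_le_rpow (hf k) h3 (by positivity)).trans_eq ?_
    rw [Real.mul_rpow hC.le (by positivity), one_div, Real.pow_rpow_inv_natCast h0.le hk.ne']
  · rw [hlim.limsup_eq]
    exact ENNReal.ofReal_lt_one.2 h1

namespace BandMatrix

variable {N r s : ℕ}

/-! ### Geometric decay of the blocks of the resolvent -/

/-- The operator consisting of the diagonal number `d` (counted from the lowest one). -/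
def diagOp (A : BandMatrix N r s) (hA : A.IsBounded) (d : ℕ) : EllTwo N →L[ℂ] EllTwo N :=
  weightedShift d s
    (fun k => LinearMap.toContinuousLinearMap (Matrix.toEuclideanLin (A.entry k (k + d - s))))
    (c := hA.exists_bound.choose) (fun _ v => hA.exists_bound.choose_spec.2 _ _ v)

theorem diagOp_apply (A : BandMatrix N r s) (hA : A.IsBounded) (d : ℕ) (u : EllTwo N) (k : ℕ) :
    A.diagOp hA d u k = if s ≤ k + d then
      Matrix.toEuclideanLin (A.entry k (k + d - s)) (u (k + d - s)) else 0 := rfl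

theorem operator_eq_sum_diagOp (A : BandMatrix N r s) (hA : A.IsBounded) :
    A.operator hA = ∑ d ∈ Finset.range (r + s + 1), A.diagOp hA d := by
  ext1 u
  ext1
  funext k
  rw [_root_.sum_apply, lp.coeFn_sum, Finset.sum_apply]
  exact A.act_eq_sum_diag u k

/-- Diagonal `d` links row `k` to column `k + d - s`, so moving `D` across it costs `q^{d-s}`.
Splitting this factor between the two sides keeps the exponents natural and needs no division by
`q`. -/
theorem diagOp_mul_geomOp (A : BandMatrix N r s) (hA : A.IsBounded) (d : ℕ) {q : ℝ}
    (h0 : 0 ≤ q) (h1 : q ≤ 1) :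
    (q : ℂ) ^ s • (A.diagOp hA d * geomOp N q h0 h1)
      = (q : ℂ) ^ d • (geomOp N q h0 h1 * A.diagOp hA d) := by
  ext1 u
  ext1
  funext k
  simp only [_root_.smul_apply, mul_apply_eq_comp, lp.coeFn_smul,
    Pi.smul_apply, geomOp_apply, diagOp_apply]
  split_ifs with h
  · rw [map_smul, smul_smul, smul_smul, ← pow_add, ← pow_add]
    congr 2
    omega
  · simp

/-- The matrix `(q^{l-k} A_{k,l})` as an operator. -/
def twist (A : BandMatrix N r s) (hA : A.IsBounded) (q : ℝ) : EllTwo N →L[ℂ] EllTwo N :=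
  ∑ d ∈ Finset.range (r + s + 1), ((q : ℂ) ^ d * ((q : ℂ) ^ s)⁻¹) • A.diagOp hA d

theorem twist_one (A : BandMatrix N r s) (hA : A.IsBounded) :
    A.twist hA 1 = A.operator hA := by
  simp [twist, operator_eq_sum_diagOp]

theorem continuousAt_twist (A : BandMatrix N r s) (hA : A.IsBounded) :
    ContinuousAt (A.twist hA) 1 := by
  unfold twist
  refine tendsto_finsetSum _ fun d _ => ?_
  have h : ContinuousAt (fun q : ℝ => (q : ℂ) ^ d * ((q : ℂ) ^ s)⁻¹) 1 := by
    refine ContinuousAt.mul (by fun_prop) (ContinuousAt.inv₀ (by fun_prop) (by simp))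
  exact h.smul continuousAt_const

/-- This is `D⁻¹ A D = A.twist hA q` in intertwining form, because the formal inverse of `D` need
not be bounded. Likewise `geomOp_mul_operator` expresses `D A D⁻¹`, whose parameter is `q⁻¹`. -/
theorem operator_mul_geomOp (A : BandMatrix N r s) (hA : A.IsBounded) {q : ℝ}
    (h0 : 0 < q) (h1 : q ≤ 1) :
    A.operator hA * geomOp N q h0.le h1 = geomOp N q h0.le h1 * A.twist hA q := by
  have hq : (q : ℂ) ≠ 0 := by exact_mod_cast h0.ne'
  rw [operator_eq_sum_diagOp, twist, Finset.sum_mul, Finset.mul_sum]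
  refine Finset.sum_congr rfl fun d _ => ?_
  rw [mul_smul_comm, mul_comm, mul_smul, ← diagOp_mul_geomOp, smul_smul,
    inv_mul_cancel₀ (pow_ne_zero _ hq), one_smul]

theorem geomOp_mul_operator (A : BandMatrix N r s) (hA : A.IsBounded) {q : ℝ}
    (h0 : 0 < q) (h1 : q ≤ 1) :
    geomOp N q h0.le h1 * A.operator hA = A.twist hA q⁻¹ * geomOp N q h0.le h1 := by
  have hq : (q : ℂ) ≠ 0 := by exact_mod_cast h0.ne'
  rw [operator_eq_sum_diagOp, twist, Finset.sum_mul, Finset.mul_sum]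
  refine Finset.sum_congr rfl fun d _ => ?_
  rw [smul_mul_assoc, Complex.ofReal_inv, inv_pow, inv_pow, inv_inv, mul_smul, diagOp_mul_geomOp,
    smul_smul, inv_mul_cancel₀ (pow_ne_zero _ hq), one_smul]

/-- At `q = 1` the twist is `A` itself, the twist is norm-continuous there, and the units form an
open set. Both `q` and `q⁻¹` are near `1`, so a single `q` slightly below `1` serves both
conditions. -/
theorem exists_isUnit_twist (A : BandMatrix N r s) (hA : A.IsBounded) {z : ℂ}
    (hz : z ∈ resolventSet ℂ (A.operator hA)) :
    ∃ q : ℝ, 0 < q ∧ q < 1 ∧ IsUnit (z • 1 - A.twist hA q) ∧ IsUnit (z • 1 - A.twist hA q⁻¹) := by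
  have hu : IsUnit (z • 1 - A.twist hA 1) := by
    rw [twist_one]
    simpa [resolventSet, Algebra.algebraMap_eq_smul_one] using hz
  have hc : ContinuousAt (fun q => z • 1 - A.twist hA q) 1 :=
    continuousAt_const.sub (A.continuousAt_twist hA)
  have e1 : ∀ᶠ q in 𝓝 (1 : ℝ), IsUnit (z • 1 - A.twist hA q) :=
    hc.eventually (Units.isOpen.mem_nhds hu)
  have hinv : Tendsto (fun q : ℝ => q⁻¹) (𝓝 1) (𝓝 1) := by
    simpa using (continuousAt_inv₀ (one_ne_zero (α := ℝ))).tendsto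
  have e2 := hinv.eventually e1
  have e3 : ∀ᶠ q in 𝓝 (1 : ℝ), 0 < q := lt_mem_nhds one_pos
  have hall : ∀ᶠ q in 𝓝[<] (1 : ℝ), 0 < q ∧ q < 1 ∧ IsUnit (z • 1 - A.twist hA q) ∧
      IsUnit (z • 1 - A.twist hA q⁻¹) := by
    filter_upwards [nhdsWithin_le_nhds e1, nhdsWithin_le_nhds e2, nhdsWithin_le_nhds e3,
      self_mem_nhdsWithin] with q a b c d using ⟨c, d, a, b⟩
  exact hall.exists

theorem sub_mul_resolvent (A : BandMatrix N r s) (hA : A.IsBounded) {z : ℂ}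
    (hz : z ∈ resolventSet ℂ (A.operator hA)) :
    (z • 1 - A.operator hA) * resolvent (A.operator hA) z = 1 := by
  rw [← Algebra.algebraMap_eq_smul_one]
  exact Ring.mul_inverse_cancel _ hz

theorem resolvent_mul_sub (A : BandMatrix N r s) (hA : A.IsBounded) {z : ℂ}
    (hz : z ∈ resolventSet ℂ (A.operator hA)) :
    resolvent (A.operator hA) z * (z • 1 - A.operator hA) = 1 := by
  rw [← Algebra.algebraMap_eq_smul_one]
  exact Ring.inverse_mul_cancel _ hz

/-- The blocks of the resolvent of a band matrix decay geometrically away from the diagonal. -/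
theorem exists_decay (A : BandMatrix N r s) (hA : A.IsBounded) {z : ℂ}
    (hz : z ∈ resolventSet ℂ (A.operator hA)) :
    ∃ q C : ℝ, 0 < q ∧ q < 1 ∧ ∀ (i j : ℕ) (a b : Fin N),
      ‖blockOf (resolvent (A.operator hA) z) i j a b‖ ≤ C * (q ^ j)⁻¹ * q ^ i ∧
      ‖blockOf (resolvent (A.operator hA) z) i j a b‖ ≤ C * (q ^ i)⁻¹ * q ^ j := by
  obtain ⟨q, h0, h1, ⟨U, hU⟩, ⟨V, hV⟩⟩ := A.exists_isUnit_twist hA hz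
  set T := resolvent (A.operator hA) z with hT
  set D := geomOp N q h0.le h1.le with hD
  have hq : (q : ℂ) ≠ 0 := by exact_mod_cast h0.ne'
  set S : EllTwo N →L[ℂ] EllTwo N := ↑U⁻¹
  set S' : EllTwo N →L[ℂ] EllTwo N := ↑V⁻¹
  -- Multiplying these two intertwining relations by `T` on one side and by the inverse of the unit
  -- on the other gives `T D = D S` and `D T = S' D`, without ever inverting `D`.
  have c1 : (z • 1 - A.operator hA) * D = D * U := by
    rw [hU, sub_mul, mul_sub, A.operator_mul_geomOp hA h0 h1.le]
    simp [hD]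
  have c2 : D * (z • 1 - A.operator hA) = V * D := by
    rw [hV, sub_mul, mul_sub, A.geomOp_mul_operator hA h0 h1.le]
    simp [hD]
  have k1 : T * D = D * S := by
    calc T * D = T * (D * U) * S := by rw [mul_assoc, mul_assoc, Units.mul_inv, mul_one]
      _ = (T * (z • 1 - A.operator hA)) * D * S := by rw [← c1]; simp only [mul_assoc]
      _ = D * S := by rw [hT, A.resolvent_mul_sub hA hz, one_mul]
  have k2 : D * T = S' * D := by
    calc D * T = S' * (V * D) * T := by
          rw [← mul_assoc S', Units.inv_mul, one_mul]
      _ = S' * D * ((z • 1 - A.operator hA) * T) := by rw [← c2]; simp only [mul_assoc]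
      _ = S' * D := by rw [hT, A.sub_mul_resolvent hA hz, mul_one]
  -- In block `(i, j)`, a factor `D` on the right contributes `q^j` and one on the left `q^i`.
  have b1 : ∀ (i j : ℕ) (a b : Fin N),
      (q : ℂ) ^ j * blockOf T i j a b = (q : ℂ) ^ i * blockOf S i j a b := by
    intro i j a b
    have := congrArg (fun W : EllTwo N →L[ℂ] EllTwo N => blockOf W i j a b) k1
    simpa [blockOf, hD, geomOp_single, geomOp_apply] using this
  have b2 : ∀ (i j : ℕ) (a b : Fin N),
      (q : ℂ) ^ i * blockOf T i j a b = (q : ℂ) ^ j * blockOf S' i j a b := by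
    intro i j a b
    have := congrArg (fun W : EllTwo N →L[ℂ] EllTwo N => blockOf W i j a b) k2
    simpa [blockOf, hD, geomOp_single, geomOp_apply] using this
  have key : ∀ (m n : ℕ) (x y : ℂ) (c : ℝ), (q : ℂ) ^ m * x = (q : ℂ) ^ n * y → ‖y‖ ≤ c →
      ‖x‖ ≤ c * (q ^ m)⁻¹ * q ^ n := by
    intro m n x y c hxy hy
    have h := congrArg norm hxy
    simp only [norm_mul, norm_pow, Complex.norm_real, Real.norm_of_nonneg h0.le] at h
    have hm : 0 < q ^ m := by positivity
    have : ‖x‖ = ‖y‖ * (q ^ m)⁻¹ * q ^ n := by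
      field_simp
      linarith
    rw [this]
    gcongr
  refine ⟨q, ‖S‖ + ‖S'‖, h0, h1, fun i j a b => ⟨?_, ?_⟩⟩
  · exact key _ _ _ _ _ (b1 i j a b)
      ((norm_blockOf_le S i j a b).trans (le_add_of_nonneg_right (norm_nonneg _)))
  · exact key _ _ _ _ _ (b2 i j a b)
      ((norm_blockOf_le S' i j a b).trans (le_add_of_nonneg_left (norm_nonneg _)))

/-! ### The equations satisfied by the blocks of the resolvent -/

theorem blockOf_operator_mul (A : BandMatrix N r s) (hA : A.IsBounded)
    (T : EllTwo N →L[ℂ] EllTwo N) (k j : ℕ) :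
    blockOf (A.operator hA * T) k j
      = ∑ l ∈ Finset.range (k + r + 1), A.entry k l * blockOf T l j := by
  ext a b
  rw [Matrix.sum_apply]
  simp only [blockOf, Matrix.of_apply, mul_apply_eq_comp, operator_apply,
    WithLp.ofLp_sum, Finset.sum_apply]
  rfl

/-- Column `k` of the band matrix ends at row `k + s`, so the image of a unit vector is a finite
combination of unit vectors. A bounded `T` can thus be applied termwise, with no convergence
question, to obtain the blocks of `T A`. -/
theorem operator_single (A : BandMatrix N r s) (hA : A.IsBounded) (k : ℕ) (b : Fin N) :
    A.operator hA (lp.single 2 k (EuclideanSpace.single b (1 : ℂ)))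
      = ∑ l ∈ Finset.range (k + s + 1), ∑ a : Fin N,
        A.entry l k a b • lp.single 2 l (EuclideanSpace.single a (1 : ℂ)) := by
  have hcol : ∀ X : Blk N, Matrix.toEuclideanLin X (EuclideanSpace.single b (1 : ℂ))
      = ∑ a : Fin N, X a b • EuclideanSpace.single a (1 : ℂ) := by
    intro X
    ext a
    simp [Matrix.toLpLin_apply, Pi.single_apply]
  ext1
  funext m
  have hL : A.operator hA (lp.single 2 k (EuclideanSpace.single b (1 : ℂ))) m
      = Matrix.toEuclideanLin (A.entry m k) (EuclideanSpace.single b (1 : ℂ)) := by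
    rw [operator_apply, Finset.sum_eq_single k]
    · simp
    · intro l _ hl
      simp [lp.single_apply, Pi.single_eq_of_ne hl]
    · intro h
      rw [A.upper_zero m k (by simpa using h)]
      simp
  have hR : ∀ l, (∑ a : Fin N,
        A.entry l k a b • lp.single 2 l (EuclideanSpace.single a (1 : ℂ)) : EllTwo N) m
      = if m = l then Matrix.toEuclideanLin (A.entry l k) (EuclideanSpace.single b (1 : ℂ))
        else 0 := by
    intro l
    rw [lp.coeFn_sum, Finset.sum_apply, hcol]
    split_ifs with h
    · subst h; simp
    · refine Finset.sum_eq_zero fun a _ => ?_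
      simp [lp.single_apply, Pi.single_eq_of_ne h]
  rw [hL, lp.coeFn_sum, Finset.sum_apply]
  simp only [hR]
  rw [Finset.sum_ite_eq]
  split_ifs with h
  · rfl
  · rw [A.lower_zero m k (by simpa using h)]
    simp

theorem blockOf_mul_operator (A : BandMatrix N r s) (hA : A.IsBounded)
    (T : EllTwo N →L[ℂ] EllTwo N) (i k : ℕ) :
    blockOf (T * A.operator hA) i k
      = ∑ l ∈ Finset.range (k + s + 1), blockOf T i l * A.entry l k := by
  ext a b
  rw [Matrix.sum_apply]
  simp only [blockOf, Matrix.of_apply, mul_apply_eq_comp, operator_single, map_sum,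
    map_smul, lp.coeFn_sum, Finset.sum_apply, WithLp.ofLp_sum, lp.coeFn_smul, Pi.smul_apply,
    PiLp.smul_apply, smul_eq_mul, Matrix.mul_apply]
  exact Finset.sum_congr rfl fun l _ => Finset.sum_congr rfl fun c _ => mul_comm _ _

/-- A sum over the band splits into its nonnegative part and one term of negative index. -/
theorem sum_Icc_band {p t : ℕ} (m : ℕ) (f : ℤ → Blk N)
    (hneg : ∀ l : ℤ, l < 0 → l ≠ m - p → f l = 0)
    (hpos : ∀ l : ℕ, l + p < m → f l = 0) :
    ∑ l ∈ Finset.Icc ((m : ℤ) - p) (m + t), f l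
      = ∑ l ∈ Finset.range (m + t + 1), f l + if m < p then f (m - p) else 0 := by
  have h1 : ∑ l ∈ Finset.Icc ((m : ℤ) - p) (m + t), f l
      = ∑ l ∈ Finset.Icc (-(p : ℤ)) (m + t), f l := by
    -- The indices added below `m - p` contribute nothing: the negative ones by `hneg`, the others
    -- by `hpos`.
    refine Finset.sum_subset (Finset.Icc_subset_Icc_left (by omega)) fun l hl hl' => ?_
    simp only [Finset.mem_Icc] at hl hl'
    by_cases h : l < 0
    · exact hneg l h (by omega)
    · lift l to ℕ using by omega
      exact hpos l (by omega)
  have h2 : Finset.Icc (-(p : ℤ)) (m + t)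
      = (Finset.range (m + t + 1)).map Nat.castEmbedding ∪ Finset.Ico (-(p : ℤ)) 0 := by
    ext l
    simp only [Finset.mem_Icc, Finset.mem_union, Finset.mem_map, Finset.mem_range,
      Nat.castEmbedding_apply, Finset.mem_Ico]
    constructor
    · intro h
      by_cases hl : l < 0
      · right; omega
      · left; exact ⟨l.toNat, by omega, by omega⟩
    · rintro (⟨a, h, rfl⟩ | h) <;> omega
  rw [h1, h2, Finset.sum_union, Finset.sum_map]
  · congr 1
    split_ifs with h
    · refine Finset.sum_eq_single _ (fun l hl hne => hneg l (Finset.mem_Ico.1 hl).2 hne) fun hn => ?_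
      exact absurd (Finset.mem_Ico.2 ⟨by omega, by omega⟩) hn
    · refine Finset.sum_eq_zero fun l hl => hneg l (Finset.mem_Ico.1 hl).2 ?_
      have := (Finset.mem_Ico.1 hl).2
      omega
  · rw [Finset.disjoint_left]
    intro l hl hl'
    simp only [Finset.mem_map, Nat.castEmbedding_apply, Finset.mem_Ico] at hl hl'
    obtain ⟨a, -, rfl⟩ := hl
    omega

theorem ext_natCast (A : BandMatrix N r s) (k l : ℕ) : A.ext k l = A.entry k l := by
  simp [ext]

theorem ext_of_col_neg (A : BandMatrix N r s) (k : ℕ) {l : ℤ} (hl : l < 0) :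
    A.ext k l = if l = k - s then -1 else 0 := by
  have h1 : ¬ (0 : ℤ) ≤ l := by omega
  simp [ext, h1]

theorem ext_of_row_neg (A : BandMatrix N r s) (l : ℕ) {k : ℤ} (hk : k < 0) :
    A.ext k l = if k = l - r then -1 else 0 := by
  have h1 : ¬ (0 : ℤ) ≤ k := by omega
  simp [ext, h1]

/-- The sequence with the values `f k` for `k ≥ 0` and the only other nonzero value `-E` at the
negative index `m`. -/
def extendNeg (f : ℕ → Blk N) (m k : ℤ) : Blk N :=
  if 0 ≤ k then f k.toNat else -unitInit N m k

/-- Column `j` of `(z - A) T = 1` is the recurrence with inhomogeneity `δ_{k,j} E`. The product of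
`A_{j,j-s} = -E` with the value `-E` at `j - s` supplies exactly this term. -/
theorem isSolution_extendNeg_blockOf_resolvent (A : BandMatrix N r s) (hA : A.IsBounded) {z : ℂ}
    (hz : z ∈ resolventSet ℂ (A.operator hA)) {j : ℕ} (hj : j < s) :
    A.IsSolution z (extendNeg (fun k => blockOf (resolvent (A.operator hA) z) k j) (j - s)) := by
  intro k hk
  lift k to ℕ using hk
  rw [sum_Icc_band]
  · have h := congrArg (fun W : EllTwo N →L[ℂ] EllTwo N => blockOf W k j)
      (A.sub_mul_resolvent hA hz)
    simp only [sub_mul, smul_mul_assoc, one_mul, blockOf_smul_one_sub, blockOf_operator_mul,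
      blockOf_one] at h
    have e1 : ∀ l : ℕ, extendNeg (fun k => blockOf (resolvent (A.operator hA) z) k j)
        ((j : ℤ) - s) l = blockOf (resolvent (A.operator hA) z) l j := by
      intro l; simp [extendNeg]
    have e2 : (if k < s then A.ext k (k - s) *
          extendNeg (fun k => blockOf (resolvent (A.operator hA) z) k j) ((j : ℤ) - s) (k - s)
        else 0) = if k = j then 1 else 0 := by
      by_cases h1 : k < s
      · rw [if_pos h1, ext_of_col_neg _ _ (by omega), if_pos rfl, extendNeg, if_neg (by omega)]
        by_cases h2 : k = j <;> simp [unitInit, h2]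
      · rw [if_neg h1, if_neg (by omega)]
    simp only [e1, ext_natCast, e2]
    rw [← h]
    abel
  · intro l hl hne
    rw [ext_of_col_neg _ _ hl, if_neg hne, zero_mul]
  · intro l hl
    rw [ext_natCast, A.lower_zero k l hl, zero_mul]

/-- The same device for row `i` of `T (z - A) = 1`, now with `A_{i-r,i} = -E`. -/
theorem isDualSolution_extendNeg_blockOf_resolvent (A : BandMatrix N r s) (hA : A.IsBounded)
    {z : ℂ} (hz : z ∈ resolventSet ℂ (A.operator hA)) {i : ℕ} (hi : i < r) :
    A.IsDualSolution z (extendNeg (blockOf (resolvent (A.operator hA) z) i) (i - r)) := by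
  intro k hk
  lift k to ℕ using hk
  rw [sum_Icc_band]
  · have h := congrArg (fun W : EllTwo N →L[ℂ] EllTwo N => blockOf W i k)
      (A.resolvent_mul_sub hA hz)
    simp only [mul_sub, mul_smul_comm, mul_one, blockOf_smul_one_sub, blockOf_mul_operator,
      blockOf_one] at h
    have e1 : ∀ l : ℕ, extendNeg (blockOf (resolvent (A.operator hA) z) i)
        ((i : ℤ) - r) l = blockOf (resolvent (A.operator hA) z) i l := by
      intro l; simp [extendNeg]
    have e2 : (if k < r then
          extendNeg (blockOf (resolvent (A.operator hA) z) i) ((i : ℤ) - r) (k - r) *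
            A.ext (k - r) k
        else 0) = if i = k then 1 else 0 := by
      by_cases h1 : k < r
      · rw [if_pos h1, ext_of_row_neg _ _ (by omega), if_pos rfl, extendNeg, if_neg (by omega)]
        by_cases h2 : k = i <;> simp [unitInit, h2, eq_comm]
      · rw [if_neg h1, if_neg (by omega)]
    simp only [e1, ext_natCast, e2]
    rw [← h]
    abel
  · intro l hl hne
    rw [ext_of_row_neg _ _ hl, if_neg hne, mul_zero]
  · intro l hl
    rw [ext_natCast, A.upper_zero l k hl, mul_zero]

/-! ### Uniqueness of solutions -/

theorem IsSolution.sub {A : BandMatrix N r s} {z : ℂ} {Y Z : ℤ → Blk N}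
    (hY : A.IsSolution z Y) (hZ : A.IsSolution z Z) : A.IsSolution z (fun k => Y k - Z k) := by
  intro k hk
  simp only [mul_sub, Finset.sum_sub_distrib, hY k hk, hZ k hk, smul_sub]

theorem IsDualSolution.sub {A : BandMatrix N r s} {z : ℂ} {Y Z : ℤ → Blk N}
    (hY : A.IsDualSolution z Y) (hZ : A.IsDualSolution z Z) :
    A.IsDualSolution z (fun k => Y k - Z k) := by
  intro k hk
  simp only [sub_mul, Finset.sum_sub_distrib, hY k hk, hZ k hk, smul_sub]

/-- If all values from `-s` up to `n + r - 1` vanish, the equation at `n` reduces to `A_{n,n+r}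
Y_{n+r} = 0`, and the block is invertible. Values below `-s` never enter. -/
theorem IsSolution.eq_zero {A : BandMatrix N r s} (hr : 0 < r) {z : ℂ} {Y : ℤ → Blk N}
    (hY : A.IsSolution z Y) (h0 : ∀ l : ℤ, -(s : ℤ) ≤ l → l < r → Y l = 0) (k : ℕ) :
    Y k = 0 := by
  have main : ∀ n : ℕ, ∀ l : ℤ, -(s : ℤ) ≤ l → l < r + n → Y l = 0 := by
    intro n
    induction n with
    | zero => simpa using h0
    | succ n ih =>
      intro l hl hl'
      by_cases h : l < r + n
      · exact ih l hl h
      have e : l = ((n + r : ℕ) : ℤ) := by push_cast at hl' ⊢; omega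
      have eq := hY n (by omega)
      rw [ih n (by omega) (by omega), smul_zero, Finset.sum_eq_single ((n + r : ℕ) : ℤ),
        ext_natCast] at eq
      · rw [e]
        exact (A.isUnit_upper n).mul_right_eq_zero.1 eq
      · intro m hm hne
        rw [Finset.mem_Icc] at hm
        push_cast at hne
        rw [ih m (by omega) (by omega), mul_zero]
      · intro hn
        exact absurd (Finset.mem_Icc.2 ⟨by push_cast; omega, by push_cast; omega⟩) hn
  exact main (k + 1) k (by omega) (by push_cast; omega)

theorem IsDualSolution.eq_zero {A : BandMatrix N r s} (hs : 0 < s) {z : ℂ} {Y : ℤ → Blk N}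
    (hY : A.IsDualSolution z Y) (h0 : ∀ l : ℤ, -(r : ℤ) ≤ l → l < s → Y l = 0) (k : ℕ) :
    Y k = 0 := by
  have main : ∀ n : ℕ, ∀ l : ℤ, -(r : ℤ) ≤ l → l < s + n → Y l = 0 := by
    intro n
    induction n with
    | zero => simpa using h0
    | succ n ih =>
      intro l hl hl'
      by_cases h : l < s + n
      · exact ih l hl h
      have e : l = ((n + s : ℕ) : ℤ) := by push_cast at hl' ⊢; omega
      have eq := hY n (by omega)
      rw [ih n (by omega) (by omega), smul_zero, Finset.sum_eq_single ((n + s : ℕ) : ℤ),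
        ext_natCast] at eq
      · rw [e]
        exact (A.isUnit_lower n).mul_left_eq_zero.1 eq
      · intro m hm hne
        rw [Finset.mem_Icc] at hm
        push_cast at hne
        rw [ih m (by omega) (by omega), zero_mul]
      · intro hn
        exact absurd (Finset.mem_Icc.2 ⟨by push_cast; omega, by push_cast; omega⟩) hn
  exact main (k + 1) k (by omega) (by push_cast; omega)

/-! ### Functions of the second kind as blocks of the resolvent -/

theorem isSolution_R (hr : 0 < r) (A : BandMatrix N r s) (z : ℂ) (M : Fin r → Fin s → Blk N)
    (j : Fin s) : A.IsSolution z (A.R z M j) := by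
  refine IsSolution.sub (Y := fun k => ∑ i : Fin r, A.Q z i k * M i j) ?_
    (isSolution_sol hr A z _)
  intro k hk
  simp only [Finset.mul_sum]
  rw [Finset.sum_comm, Finset.smul_sum]
  refine Finset.sum_congr rfl fun i _ => ?_
  simp only [← mul_assoc]
  rw [← Finset.sum_mul, Q, isSolution_sol hr A z _ k hk, smul_mul_assoc]

theorem isDualSolution_Rdual (hs : 0 < s) (A : BandMatrix N r s) (z : ℂ)
    (M : Fin r → Fin s → Blk N) (i : Fin r) : A.IsDualSolution z (A.Rdual z M i) := by
  refine IsDualSolution.sub (Y := fun k => ∑ j : Fin s, M i j * A.Qdual z j k) ?_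
    (isDualSolution_dualSol hs A z _)
  intro k hk
  simp only [Finset.sum_mul]
  rw [Finset.sum_comm, Finset.smul_sum]
  refine Finset.sum_congr rfl fun j _ => ?_
  simp only [mul_assoc]
  rw [← Finset.mul_sum, Qdual, isDualSolution_dualSol hs A z _ k hk, mul_smul_comm]

/-- The functions of the second kind are the first block columns of the resolvent. -/
theorem R_weyl (hr : 0 < r) (A : BandMatrix N r s) (hA : A.IsBounded) {z : ℂ}
    (hz : z ∈ resolventSet ℂ (A.operator hA)) (j : Fin s) (k : ℕ) :
    A.R z (A.weyl hA z) j k = blockOf (resolvent (A.operator hA) z) k j := by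
  have h := ((isSolution_R hr A z (A.weyl hA z) j).sub
    (A.isSolution_extendNeg_blockOf_resolvent hA hz j.2)).eq_zero hr ?_ k
  · simpa [extendNeg, sub_eq_zero] using h
  intro l hl hl'
  have hj := j.2
  -- Comparison of initial values. For `0 ≤ l < r` only `Q^{l+1}` survives and selects the Weyl
  -- block, which is the resolvent block `(l, j)`; for `l < 0` only `-P` remains, matching the `-E`
  -- at `j - s`.
  simp only [R, Q, P, sol_of_lt A z _ hl', sub_eq_zero, extendNeg]
  split_ifs with h0
  · lift l to ℕ using h0
    have hl2 : l < r := by omega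
    rw [Finset.sum_eq_single ⟨l, hl2⟩]
    · have : ¬ (l : ℤ) = (j : ℕ) - (s : ℤ) := by omega
      simp [unitInit, weyl, this]
    · intro i _ hi
      have : ¬ (l : ℤ) = (i : ℕ) := fun e => hi (Fin.ext (by simp; omega))
      rw [unitInit, if_neg this, zero_mul]
    · simp
  · rw [Finset.sum_eq_zero, zero_sub]
    intro i _
    rw [unitInit, if_neg (by omega), zero_mul]

/-- The dual functions of the second kind are the first block rows of the resolvent. -/
theorem Rdual_weyl (hs : 0 < s) (A : BandMatrix N r s) (hA : A.IsBounded) {z : ℂ}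
    (hz : z ∈ resolventSet ℂ (A.operator hA)) (i : Fin r) (n : ℕ) :
    A.Rdual z (A.weyl hA z) i n = blockOf (resolvent (A.operator hA) z) i n := by
  have h := ((isDualSolution_Rdual hs A z (A.weyl hA z) i).sub
    (A.isDualSolution_extendNeg_blockOf_resolvent hA hz i.2)).eq_zero hs ?_ n
  · simpa [extendNeg, sub_eq_zero] using h
  intro l hl hl'
  have hi := i.2
  simp only [Rdual, Qdual, Pdual, dualSol_of_lt A z _ hl', sub_eq_zero, extendNeg]
  split_ifs with h0
  · lift l to ℕ using h0
    have hl2 : l < s := by omega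
    rw [Finset.sum_eq_single ⟨l, hl2⟩]
    · have : ¬ (l : ℤ) = (i : ℕ) - (r : ℤ) := by omega
      simp [unitInit, weyl, this]
    · intro j _ hj
      have : ¬ (l : ℤ) = (j : ℕ) := fun e => hj (Fin.ext (by simp; omega))
      rw [unitInit, if_neg this, mul_zero]
    · simp
  · rw [Finset.sum_eq_zero, zero_sub]
    intro j _
    rw [unitInit, if_neg (by omega), mul_zero]

end BandMatrix

end

theorem corollary1 {N r s : ℕ} (hr : 0 < r) (hs : 0 < s) (A : BandMatrix N r s)
    (hA : A.IsBounded) (z : ℂ) (hz : z ∈ resolventSet ℂ (A.operator hA))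
    (ν : Seminorm ℂ (Blk N)) (hν : IsNorm ν) :
    (∀ j : Fin s,
      limsup (fun k : ℕ =>
        ENNReal.ofReal (ν (A.R z (A.weyl hA z) j (k : ℤ)) ^ (1 / (k : ℝ)))) atTop < 1) ∧
    (∀ i : Fin r,
      limsup (fun n : ℕ =>
        ENNReal.ofReal (ν (A.Rdual z (A.weyl hA z) i (n : ℤ)) ^ (1 / (n : ℝ)))) atTop < 1) := by
  obtain ⟨q, C, h0, h1, hC⟩ := A.exists_decay hA hz
  obtain ⟨K, hK⟩ := seminorm_le_of_entries ν
  refine ⟨fun j => ?_, fun i => ?_⟩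
  -- The column index `j` is fixed, so `(q ^ j)⁻¹` is absorbed into the constant; `K` converts
  -- entrywise bounds into bounds for `ν`.
  · refine limsup_root_lt_one (fun k => apply_nonneg ν _) (C := K * (C * (q ^ (j : ℕ))⁻¹)) h0 h1
      fun k => ?_
    rw [A.R_weyl hr hA hz, mul_assoc]
    exact hK _ _ fun a b => (hC k j a b).1
  · refine limsup_root_lt_one (fun k => apply_nonneg ν _) (C := K * (C * (q ^ (i : ℕ))⁻¹)) h0 h1
      fun n => ?_
    rw [A.Rdual_weyl hs hA hz, mul_assoc]
    exact hK _ _ fun a b => (hC i n a b).2
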